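/- Let $H(\mathbb C)$ be the space of entire functions with the Fréchet topology defined by the norms $$\|f\|_p=\Big(\frac1{2\pi}\int_{|z|=2^p}|f(z)|^2\,|dz|\Big)^{1/2},\qquad p\in\mathbb N,$$ and let $H'(\mathbb C)$ be its dual space, equipped with the strong topology (uniform convergence on the bounded subsets of $H(\mathbb C)$). Identify $H'(\mathbb C)$ with the space $\mathcal O_0$ of germs at $0$ of functions holomorphic near $0$, where the germ of $f(z)=\sum_{n\ge 0}a_nz^n$ corresponds to the continuous linear functional $\sum_{n\ge 0} b_nz^n\mapsto\sum_{n\ge 0}a_nb_n$ on $H(\mathbb C)$. With the multiplication of germs, $\big(\sum_n a_nz^n\big)\big(\sum_n b_nz^n\big)=\sum_n\big(\sum_{m=0}^n a_mb_{n-m}\big)z^n$, the space $H'(\mathbb C)$ is a commutative unital $\mathbb C$-algebra. The following properties hold: (a) The multiplication $H'(\mathbb C)\times H'(\mathbb C)\to H'(\mathbb C)$ is (jointly) continuous, i.e. $(H'(\mathbb C),+,\cdot)$ is a topological $\mathbb C$-algebra. (b) The group of invertible elements $GL(H'(\mathbb C))$ is open in $H'(\mathbb C)$, and the function $f\mapsto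 f^{-1}$ is continuous on it. (c) An element $f\in H'(\mathbb C)$ is invertible if and only if $f(0)\neq 0$. (d) $H'(\mathbb C)$ is nuclear, i.e. it is a Hausdorff locally convex space such that for every continuous seminorm $p$ there is a continuous seminorm $q\ge p$ for which the canonical map $\widehat E_q\to\widehat E_p$ is a nuclear operator, where $\widehat E_p$ is the Banach space obtained by completing $E=H'(\mathbb C)$ with respect to $p$. (A bounded operator $T:X\to Y$ of Banach spaces is nuclear if $Tx=\sum_n\varphi_n(x)y_n$ for all $x\in X$, with $\varphi_n\in X'$, $y_n\in Y$ and $\sum_n\|\varphi_n\|\,\|y_n\|<\infty$.) -/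

import Mathlib

open Filter Topology MeasureTheory

noncomputable section

/-! ## Nuclear locally convex spaces -/

namespace NuclearDef

variable {E : Type*} [AddCommGroup E] [Module ℂ E]

/-- The space `E` equipped with the single seminorm `p`. -/
def SeminormSpace (_p : Seminorm ℂ E) : Type _ := E

instance (p : Seminorm ℂ E) : AddCommGroup (SeminormSpace p) := inferInstanceAs (AddCommGroup E)

instance (p : Seminorm ℂ E) : Module ℂ (SeminormSpace p) := inferInstanceAs (Module ℂ E)

/-- `p` as a seminorm on the copy `SeminormSpace p` of `E`. -/
def selfSeminorm (p : Seminorm ℂ E) : Seminorm ℂ (SeminormSpace p) := p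

instance (p : Seminorm ℂ E) : SeminormedAddCommGroup (SeminormSpace p) :=
  AddGroupSeminorm.toSeminormedAddCommGroup (selfSeminorm p).toAddGroupSeminorm

instance (p : Seminorm ℂ E) : NormedSpace ℂ (SeminormSpace p) where
  norm_smul_le c x := (map_smul_eq_mul (selfSeminorm p) c x).le

/-- The Banach space attached to the seminorm `p`: the (Hausdorff) completion of `E` with respect
to `p`, that is, the completion of the normed space `E / ker p`. -/
abbrev LocalBanach (p : Seminorm ℂ E) : Type _ := UniformSpace.Completion (SeminormSpace p)

/-- The canonical map from `E` to the Banach space attached to `p`. -/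
def toLocalBanach (p : Seminorm ℂ E) (x : E) : LocalBanach p :=
  UniformSpace.Completion.coe' (α := SeminormSpace p) x

/-- A bounded operator `T : X → Y` between Banach spaces is nuclear if
`T x = ∑ φₙ(x) yₙ` with `φₙ` in the dual of `X`, `yₙ ∈ Y` and `∑ ‖φₙ‖ ‖yₙ‖ < ∞`. -/
def IsNuclearOperator {X Y : Type*} [NormedAddCommGroup X] [NormedSpace ℂ X]
    [NormedAddCommGroup Y] [NormedSpace ℂ Y] (T : X →L[ℂ] Y) : Prop :=
  ∃ (φ : ℕ → X →L[ℂ] ℂ) (y : ℕ → Y),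
    Summable (fun n => ‖φ n‖ * ‖y n‖) ∧ ∀ x, HasSum (fun n => φ n x • y n) (T x)

/-- A complex topological vector space is nuclear if it is a Hausdorff locally convex space such
that for each continuous seminorm `p` there is a continuous seminorm `q ≥ p` for which the
canonical map from the completion with respect to `q` to the completion with respect to `p` (the
continuous linear map that extends the identity of `E`) is a nuclear operator. -/
structure IsNuclearSpace (E : Type*) [AddCommGroup E] [Module ℂ E] [TopologicalSpace E] :
    Prop where
  isTopologicalAddGroup : IsTopologicalAddGroup E
  continuousSMul : ContinuousSMul ℂ E
  locallyConvexSpace : LocallyConvexSpace ℝ E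
  t2Space : T2Space E
  exists_nuclear : ∀ p : Seminorm ℂ E, Continuous p →
    ∃ q : Seminorm ℂ E, Continuous q ∧ p ≤ q ∧
      ∃ T : LocalBanach q →L[ℂ] LocalBanach p,
        (∀ x : E, T (toLocalBanach q x) = toLocalBanach p x) ∧ IsNuclearOperator T

end NuclearDef

/-! ## Entire functions -/

namespace HolGerm

/-- The linear space of entire functions. -/
def entireSubmodule : Submodule ℂ (ℂ → ℂ) where
  carrier := {f | Differentiable ℂ f}
  add_mem' hf hg := Differentiable.add hf hg
  zero_mem' := differentiable_const 0
  smul_mem' c _ hf := Differentiable.const_smul hf c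

/-- The space `H(ℂ)` of entire functions. It is a type of its own, so that it does not carry the
topology of pointwise convergence. -/
def Entire : Type := entireSubmodule

instance : AddCommGroup Entire := inferInstanceAs (AddCommGroup entireSubmodule)

instance : Module ℂ Entire := inferInstanceAs (Module ℂ entireSubmodule)

/-- The function `ℂ → ℂ` underlying an element of `H(ℂ)`. -/
def Entire.toFun (f : Entire) : ℂ → ℂ := Subtype.val (p := (· ∈ entireSubmodule)) f

instance : CoeFun Entire (fun _ => ℂ → ℂ) := ⟨Entire.toFun⟩

theorem Entire.differentiable (f : Entire) : Differentiable ℂ f :=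
  Subtype.property (p := (· ∈ entireSubmodule)) f

theorem Entire.add_apply (f g : Entire) (z : ℂ) : (f + g) z = f z + g z := rfl

theorem Entire.smul_apply (c : ℂ) (f : Entire) (z : ℂ) : (c • f) z = c * f z := rfl

/-- `‖f‖ₚ = ((1 / 2π) ∫_{|z| = 2 ^ p} |f(z)|² |dz|) ^ (1 / 2)`, where `|dz| = 2 ^ p dθ`
is the arc length. -/
def hardyNorm (p : ℕ) (f : Entire) : ℝ :=
  Real.sqrt ((2 * Real.pi)⁻¹ *
    ∫ θ in (0 : ℝ)..(2 * Real.pi), ‖f (circleMap 0 (2 ^ p) θ)‖ ^ 2 * 2 ^ p)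

theorem Entire.continuous_circle (f : Entire) (p : ℕ) :
    Continuous fun θ : ℝ => f (circleMap 0 (2 ^ p) θ) :=
  f.differentiable.continuous.comp (continuous_circleMap 0 _)

theorem hardyNorm_eq (p : ℕ) (f : Entire) :
    hardyNorm p f = Real.sqrt ((2 * Real.pi)⁻¹ * 2 ^ p) *
      lpNorm (fun θ : ℝ => f (circleMap 0 (2 ^ p) θ)) 2
        (volume.restrict (Set.Ioc 0 (2 * Real.pi))) := by
  rw [lpNorm_eq_integral_norm_rpow_toReal (by norm_num) (by norm_num)
    (f.continuous_circle p).aestronglyMeasurable, hardyNorm,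
    intervalIntegral.integral_of_le (by positivity)]
  have : (2 : ENNReal).toReal⁻¹ = 1 / 2 := by norm_num
  rw [this, ← Real.sqrt_eq_rpow, ← Real.sqrt_mul (by positivity), integral_mul_const]
  congr 1
  simp only [ENNReal.toReal_ofNat, Real.rpow_ofNat]
  ring

theorem Entire.memLp (f : Entire) (p : ℕ) :
    MemLp (fun θ : ℝ => f (circleMap 0 (2 ^ p) θ)) 2
      (volume.restrict (Set.Ioc 0 (2 * Real.pi))) := by
  obtain ⟨C, hC⟩ := (isCompact_sphere (0 : ℂ) (2 ^ p)).exists_bound_of_continuousOn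
    f.differentiable.continuous.continuousOn
  refine MemLp.of_bound (f.continuous_circle p).aestronglyMeasurable C (Eventually.of_forall ?_)
  intro θ
  exact hC _ (circleMap_mem_sphere 0 (by positivity) θ)

/-- The norm `‖·‖ₚ` as a seminorm on `H(ℂ)`. -/
def hardySeminorm (p : ℕ) : Seminorm ℂ Entire :=
  Seminorm.of (hardyNorm p)
    (fun f g => by
      rw [hardyNorm_eq, hardyNorm_eq, hardyNorm_eq, ← mul_add]
      exact mul_le_mul_of_nonneg_left
        (lpNorm_add_le (g := fun θ : ℝ => g (circleMap 0 (2 ^ p) θ)) (f.memLp p) (by norm_num))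
        (Real.sqrt_nonneg _))
    (fun c f => by
      have h : ∀ θ : ℝ, ‖(c • f : Entire) (circleMap 0 (2 ^ p) θ)‖ ^ 2 * 2 ^ p
          = ‖c‖ ^ 2 * (‖f (circleMap 0 (2 ^ p) θ)‖ ^ 2 * 2 ^ p) := fun θ => by
        rw [Entire.smul_apply, norm_mul]; ring
      rw [hardyNorm, hardyNorm]
      simp only [h]
      rw [intervalIntegral.integral_const_mul, mul_left_comm, Real.sqrt_mul (by positivity),
        Real.sqrt_sq (norm_nonneg c)])

/-- The family of norms that defines the topology of `H(ℂ)`. -/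
def hardyFamily : SeminormFamily ℂ Entire ℕ := fun p => hardySeminorm p

/-- The Fréchet topology of `H(ℂ)`, defined by the norms `‖·‖ₚ`. -/
instance : TopologicalSpace Entire := hardyFamily.moduleFilterBasis.topology

theorem withSeminorms_hardyFamily : WithSeminorms hardyFamily := ⟨rfl⟩

instance : IsTopologicalAddGroup Entire := withSeminorms_hardyFamily.topologicalAddGroup

instance : ContinuousSMul ℂ Entire := withSeminorms_hardyFamily.continuousSMul

/-! ## Taylor coefficients -/

/-- The `n`-th Taylor coefficient of a function at `0`. -/
def taylorCoeff (f : ℂ → ℂ) (n : ℕ) : ℂ := iteratedDeriv n f 0 / (n.factorial : ℂ)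

theorem taylorCoeff_eq {f : ℂ → ℂ} {P : FormalMultilinearSeries ℂ ℂ ℂ}
    (h : HasFPowerSeriesAt f P 0) (n : ℕ) : taylorCoeff f n = P.coeff n := by
  rw [← h.analyticAt.hasFPowerSeriesAt.eq_formalMultilinearSeries h,
    FormalMultilinearSeries.coeff_ofScalars]
  rfl

theorem taylorCoeff_add {f g : ℂ → ℂ} (hf : AnalyticAt ℂ f 0) (hg : AnalyticAt ℂ g 0) (n : ℕ) :
    taylorCoeff (f + g) n = taylorCoeff f n + taylorCoeff g n := by
  obtain ⟨P, hP⟩ := hf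
  obtain ⟨Q, hQ⟩ := hg
  rw [taylorCoeff_eq (hP.add hQ), taylorCoeff_eq hP, taylorCoeff_eq hQ]
  rfl

theorem taylorCoeff_smul {f : ℂ → ℂ} (hf : AnalyticAt ℂ f 0) (c : ℂ) (n : ℕ) :
    taylorCoeff (c • f) n = c * taylorCoeff f n := by
  obtain ⟨P, hP⟩ := hf
  rw [taylorCoeff_eq (hP.const_smul (c := c)), taylorCoeff_eq hP]
  rfl

theorem Entire.analyticAt (f : Entire) : AnalyticAt ℂ f 0 :=
  f.differentiable.analyticAt 0

/-- The monomial `z ↦ z ^ n` as an entire function. -/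
def monomial (n : ℕ) : Entire :=
  Subtype.mk (p := (· ∈ entireSubmodule)) (fun z => z ^ n) (differentiable_pow n)

theorem taylorCoeff_monomial (n m : ℕ) :
    taylorCoeff (monomial n) m = if m = n then 1 else 0 := by
  have h : (monomial n : ℂ → ℂ) = fun z => z ^ n := rfl
  have h2 : ∏ i ∈ Finset.range m, ((n : ℂ) - i) = (n.descFactorial m : ℂ) := by
    rcases le_or_gt m n with hmn | hmn
    · rw [Nat.descFactorial_eq_prod_range, Nat.cast_prod]
      refine Finset.prod_congr rfl fun i hi => ?_
      rw [Nat.cast_sub ((Finset.mem_range.mp hi).le.trans hmn)]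
    · rw [Nat.descFactorial_of_lt hmn, Nat.cast_zero]
      exact Finset.prod_eq_zero (Finset.mem_range.mpr hmn) (sub_self _)
  rw [taylorCoeff, h, iteratedDeriv_eq_iterate, iter_deriv_pow, h2]
  split_ifs with hmn
  · subst hmn
    rw [Nat.descFactorial_self]
    simp [Nat.factorial_ne_zero]
  · rcases lt_or_gt_of_ne hmn with hl | hl
    · simp [zero_pow (Nat.sub_ne_zero_of_lt hl)]
    · simp [Nat.descFactorial_of_lt hl]

/-- Cauchy's estimate in terms of the norm `‖·‖ₚ`. -/
theorem norm_taylorCoeff_le (f : Entire) (p n : ℕ) :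
    ‖taylorCoeff f n‖ ≤ hardyNorm p f * ((2 ^ p)⁻¹ : ℝ) ^ n := by
  have hR : (0 : ℝ) < 2 ^ p := by positivity
  have hP := (f.differentiable.hasFPowerSeriesOnBall 0 (R := ⟨2 ^ p, hR.le⟩) hR).hasFPowerSeriesAt
  rw [taylorCoeff_eq hP, ← FormalMultilinearSeries.norm_apply_eq_norm_coef]
  refine (norm_cauchyPowerSeries_le _ _ _ _).trans ?_
  have h1 : |(2 ^ p : ℝ)| = 2 ^ p := abs_of_pos hR
  change (2 * Real.pi)⁻¹ * (∫ θ in (0 : ℝ)..(2 * Real.pi), ‖f (circleMap 0 (2 ^ p) θ)‖) *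
    |(2 ^ p : ℝ)|⁻¹ ^ n ≤ _
  rw [h1]
  refine mul_le_mul_of_nonneg_right ?_ (by positivity)
  refine Real.le_sqrt_of_sq_le ?_
  set u : ℝ → ℝ := fun θ => ‖f (circleMap 0 (2 ^ p) θ)‖ with hu
  have huc : Continuous u := (f.continuous_circle p).norm
  have hpi : (0 : ℝ) < 2 * Real.pi := by positivity
  change ((2 * Real.pi)⁻¹ * ∫ θ in (0 : ℝ)..(2 * Real.pi), u θ) ^ 2 ≤
    (2 * Real.pi)⁻¹ * ∫ θ in (0 : ℝ)..(2 * Real.pi), u θ ^ 2 * 2 ^ p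
  set m : ℝ := (2 * Real.pi)⁻¹ * ∫ θ in (0 : ℝ)..(2 * Real.pi), u θ with hm
  have hI : ∫ θ in (0 : ℝ)..(2 * Real.pi), u θ = 2 * Real.pi * m := by
    rw [hm]; field_simp
  have h0 : 0 ≤ ∫ θ in (0 : ℝ)..(2 * Real.pi), (u θ - m) ^ 2 :=
    intervalIntegral.integral_nonneg hpi.le fun θ _ => sq_nonneg _
  have h2 : ∫ θ in (0 : ℝ)..(2 * Real.pi), (u θ - m) ^ 2 =
      (∫ θ in (0 : ℝ)..(2 * Real.pi), u θ ^ 2) - 2 * Real.pi * m ^ 2 := by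
    have : ∀ θ, (u θ - m) ^ 2 = u θ ^ 2 - (2 * m) * u θ + m ^ 2 := fun θ => by ring
    simp only [this]
    rw [intervalIntegral.integral_add, intervalIntegral.integral_sub,
      intervalIntegral.integral_const_mul, hI, intervalIntegral.integral_const]
    · simp only [sub_zero, smul_eq_mul]; ring
    all_goals exact Continuous.intervalIntegrable (by fun_prop) _ _
  have h3 : 0 ≤ ∫ θ in (0 : ℝ)..(2 * Real.pi), u θ ^ 2 :=
    intervalIntegral.integral_nonneg hpi.le fun θ _ => sq_nonneg _
  rw [intervalIntegral.integral_mul_const, inv_mul_eq_div, le_div_iff₀ hpi]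
  have h4 : (1 : ℝ) ≤ 2 ^ p := one_le_pow₀ (by norm_num)
  nlinarith

theorem hardyNorm_le (f : Entire) (p : ℕ) {C : ℝ} (hC0 : 0 ≤ C)
    (hC : ∀ z : ℂ, ‖z‖ = 2 ^ p → ‖f z‖ ≤ C) : hardyNorm p f ≤ 2 ^ p * C := by
  have hpi : (0 : ℝ) < 2 * Real.pi := by positivity
  have h4 : (1 : ℝ) ≤ 2 ^ p := one_le_pow₀ (by norm_num)
  rw [hardyNorm, Real.sqrt_le_left (by positivity)]
  have : ∫ θ in (0 : ℝ)..(2 * Real.pi), ‖f (circleMap 0 (2 ^ p) θ)‖ ^ 2 * 2 ^ p ≤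
      ∫ θ in (0 : ℝ)..(2 * Real.pi), C ^ 2 * 2 ^ p := by
    refine intervalIntegral.integral_mono_on hpi.le ?_ (by simp) ?_
    · have := f.continuous_circle p
      exact ((this.norm.pow 2).mul_const _).intervalIntegrable _ _
    · intro θ _
      have : ‖f (circleMap 0 (2 ^ p) θ)‖ ≤ C := hC _ (by simp)
      gcongr
  rw [intervalIntegral.integral_const, sub_zero, smul_eq_mul] at this
  rw [inv_mul_eq_div, div_le_iff₀ hpi]
  refine this.trans ?_
  rw [mul_pow, sq (2 ^ p : ℝ)]
  have h5 : 0 ≤ C ^ 2 * 2 ^ p * (2 * Real.pi) := by positivity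
  nlinarith

theorem hardyNorm_monomial_le (p n : ℕ) : hardyNorm p (monomial n) ≤ 2 ^ p * (2 ^ p) ^ n := by
  refine hardyNorm_le _ p (by positivity) fun z hz => ?_
  change ‖z ^ n‖ ≤ _
  rw [norm_pow, hz]

/-- The Taylor series of an entire function converges to it in `H(ℂ)`. -/
theorem tendsto_taylor (f : Entire) :
    Tendsto (fun N => ∑ n ∈ Finset.range N, taylorCoeff f n • monomial n) atTop (𝓝 f) := by
  rw [withSeminorms_hardyFamily.tendsto_nhds]
  intro p ε hε
  have hP := f.differentiable.hasFPowerSeriesOnBall 0 (R := 1) one_pos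
  have hU := hP.tendstoUniformlyOn (r' := 2 ^ p + 1) ENNReal.coe_lt_top
  rw [Metric.tendstoUniformlyOn_iff] at hU
  filter_upwards [hU (ε / (2 * 2 ^ p)) (by positivity)] with N hN
  have key : hardyNorm p (∑ n ∈ Finset.range N, taylorCoeff f n • monomial n - f) ≤
      2 ^ p * (ε / (2 * 2 ^ p)) := by
    refine hardyNorm_le _ p (by positivity) fun z hz => ?_
    have hz' : z ∈ Metric.ball (0 : ℂ) ((2 ^ p + 1 : NNReal) : ℝ) := by
      rw [mem_ball_zero_iff, hz]; push_cast; linarith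
    have h1 := (hN z hz').le
    rw [dist_comm, dist_eq_norm, zero_add] at h1
    refine le_of_eq_of_le (congrArg norm ?_) h1
    have h2 : ∀ g : Entire, (g - f : Entire) z = g z - f z := fun g => rfl
    rw [h2]
    congr 1
    have h3 : ∀ s : Finset ℕ, (∑ n ∈ s, taylorCoeff f n • monomial n : Entire) z =
        ∑ n ∈ s, taylorCoeff f n * z ^ n := by
      intro s
      induction s using Finset.induction_on with
      | empty => simp; rfl
      | insert a s ha ih =>
        rw [Finset.sum_insert ha, Finset.sum_insert ha, Entire.add_apply, ih]; rfl
    rw [h3, FormalMultilinearSeries.partialSum]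
    refine Finset.sum_congr rfl fun n _ => ?_
    rw [FormalMultilinearSeries.apply_eq_pow_smul_coeff, taylorCoeff_eq hP.hasFPowerSeriesAt,
      smul_eq_mul, mul_comm]
  refine lt_of_le_of_lt key ?_
  rw [mul_div_assoc', mul_comm, mul_div_mul_right _ _ (by positivity)]
  linarith

/-! ## Germs of holomorphic functions at zero -/

instance : Algebra ℂ ((𝓝 (0 : ℂ)).Germ ℂ) :=
  Algebra.ofModule
    (fun c f g => Filter.Germ.inductionOn₂ f g fun a b => by
      exact congrArg _ (funext fun z => smul_mul_assoc c (a z) (b z)))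
    (fun c f g => Filter.Germ.inductionOn₂ f g fun a b => by
      exact congrArg _ (funext fun z => mul_smul_comm c (a z) (b z)))

/-- The algebra of germs at `0` of functions that are holomorphic near `0`, with pointwise
operations. -/
def holSubalgebra : Subalgebra ℂ ((𝓝 (0 : ℂ)).Germ ℂ) where
  carrier := {g | ∃ f : ℂ → ℂ, AnalyticAt ℂ f 0 ∧ (f : (𝓝 (0 : ℂ)).Germ ℂ) = g}
  mul_mem' := by
    rintro _ _ ⟨f, hf, rfl⟩ ⟨g, hg, rfl⟩
    exact ⟨f * g, hf.mul hg, rfl⟩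
  add_mem' := by
    rintro _ _ ⟨f, hf, rfl⟩ ⟨g, hg, rfl⟩
    exact ⟨f + g, hf.add hg, rfl⟩
  algebraMap_mem' c := ⟨c • (1 : ℂ → ℂ), (analyticAt_const (v := c • (1 : ℂ))), by
    rw [Algebra.algebraMap_eq_smul_one]; rfl⟩

/-- The algebra `𝒪₀ = H'(ℂ)` of germs of holomorphic functions at `0`. -/
def HoloGerm : Type := holSubalgebra

instance : CommRing HoloGerm := inferInstanceAs (CommRing holSubalgebra)

instance : Algebra ℂ HoloGerm := inferInstanceAs (Algebra ℂ holSubalgebra)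

/-- The germ at `0` of a function that is holomorphic near `0`. -/
def HoloGerm.mk (f : ℂ → ℂ) (hf : AnalyticAt ℂ f 0) : HoloGerm :=
  Subtype.mk (p := (· ∈ holSubalgebra)) (f : (𝓝 (0 : ℂ)).Germ ℂ) ⟨f, hf, rfl⟩

/-- The underlying germ of an element of `𝒪₀`. -/
def HoloGerm.toGerm (g : HoloGerm) : (𝓝 (0 : ℂ)).Germ ℂ :=
  Subtype.val (p := (· ∈ holSubalgebra)) g

theorem HoloGerm.exists_rep (g : HoloGerm) : ∃ f hf, g = HoloGerm.mk f hf := by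
  obtain ⟨f, hf, h⟩ := Subtype.property (p := (· ∈ holSubalgebra)) g
  exact ⟨f, hf, Subtype.ext h.symm⟩

/-- The value `f(0)` of a germ `f` at `0`. -/
def HoloGerm.valueAtZero (g : HoloGerm) : ℂ := Filter.Germ.value g.toGerm

/-- The `n`-th Taylor coefficient of a germ. -/
def HoloGerm.coeff (g : HoloGerm) (n : ℕ) : ℂ :=
  Filter.Germ.liftOn g.toGerm (fun f => taylorCoeff f n) fun f f' h => by
    simp only [taylorCoeff]; rw [Filter.EventuallyEq.iteratedDeriv_eq n h]

theorem HoloGerm.coeff_mk (f : ℂ → ℂ) (hf : AnalyticAt ℂ f 0) (n : ℕ) :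
    (HoloGerm.mk f hf).coeff n = taylorCoeff f n := rfl

theorem HoloGerm.coeff_add (g h : HoloGerm) (n : ℕ) : (g + h).coeff n = g.coeff n + h.coeff n := by
  obtain ⟨f, hf, rfl⟩ := g.exists_rep
  obtain ⟨k, hk, rfl⟩ := h.exists_rep
  exact taylorCoeff_add hf hk n

theorem HoloGerm.coeff_smul (c : ℂ) (g : HoloGerm) (n : ℕ) : (c • g).coeff n = c * g.coeff n := by
  obtain ⟨f, hf, rfl⟩ := g.exists_rep
  exact taylorCoeff_smul hf c n

theorem HoloGerm.ext_coeff {g h : HoloGerm} (H : ∀ n, g.coeff n = h.coeff n) : g = h := by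
  obtain ⟨f, hf, rfl⟩ := g.exists_rep
  obtain ⟨k, hk, rfl⟩ := h.exists_rep
  have h1 := hf.hasFPowerSeriesAt
  have h2 := hk.hasFPowerSeriesAt
  have h3 : (fun n : ℕ => iteratedDeriv n f 0 / (n.factorial : ℂ)) =
    fun n : ℕ => iteratedDeriv n k 0 / (n.factorial : ℂ) := funext H
  rw [h3] at h1
  refine Subtype.ext (Filter.Germ.coe_eq.mpr ?_)
  filter_upwards [h1.eventually_hasSum, h2.eventually_hasSum] with z hz1 hz2
  simpa using hz1.unique hz2

/-- The Taylor coefficients of a germ grow at most exponentially. -/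
theorem HoloGerm.exists_bound (g : HoloGerm) :
    ∃ (C : ℝ) (p : ℕ), 0 ≤ C ∧ ∀ n, ‖g.coeff n‖ ≤ C * (2 ^ p) ^ n := by
  obtain ⟨f, hf, rfl⟩ := g.exists_rep
  have hP := hf.hasFPowerSeriesAt
  obtain ⟨r, hr0, hr⟩ := ENNReal.lt_iff_exists_nnreal_btwn.mp hP.radius_pos
  obtain ⟨C, hC, h⟩ := FormalMultilinearSeries.norm_mul_pow_le_of_lt_radius _ hr
  have hr0' : (0 : ℝ) < r := by exact_mod_cast hr0
  obtain ⟨p, hp⟩ := pow_unbounded_of_one_lt ((r : ℝ)⁻¹) one_lt_two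
  refine ⟨C, p, hC.le, fun n => ?_⟩
  have h1 := h n
  rw [FormalMultilinearSeries.norm_apply_eq_norm_coef,
    FormalMultilinearSeries.coeff_ofScalars] at h1
  change ‖taylorCoeff f n‖ * _ ≤ C at h1
  rw [HoloGerm.coeff_mk]
  rw [← le_div_iff₀ (by positivity)] at h1
  refine h1.trans ?_
  rw [div_eq_mul_inv, ← inv_pow]
  gcongr

theorem HoloGerm.norm_pairing_le {g : HoloGerm} {C : ℝ} {p : ℕ} (hC : 0 ≤ C)
    (h : ∀ n, ‖g.coeff n‖ ≤ C * (2 ^ p) ^ n) (b : Entire) (n : ℕ) :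
    ‖g.coeff n * taylorCoeff b n‖ ≤ C * hardyNorm (p + 1) b * (1 / 2) ^ n := by
  rw [norm_mul]
  refine (mul_le_mul (h n) (norm_taylorCoeff_le b (p + 1) n) (norm_nonneg _)
    (by positivity)).trans_eq ?_
  have : ((2 ^ (p + 1))⁻¹ : ℝ) ^ n = ((2 ^ p : ℝ) ^ n)⁻¹ * (1 / 2) ^ n := by
    rw [pow_succ, mul_inv, mul_pow, inv_pow]; norm_num
  rw [this]
  have h2 : ((2 : ℝ) ^ p) ^ n ≠ 0 := by positivity
  field_simp

theorem HoloGerm.summable_pairing (g : HoloGerm) (b : Entire) :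
    Summable fun n => g.coeff n * taylorCoeff b n := by
  obtain ⟨C, p, hC, h⟩ := g.exists_bound
  exact Summable.of_norm_bounded
    ((summable_geometric_of_lt_one (by norm_num) (by norm_num)).mul_left _)
    (HoloGerm.norm_pairing_le hC h b)

/-- The linear form `∑ bₙ zⁿ ↦ ∑ aₙ bₙ` on `H(ℂ)` defined by the germ `∑ aₙ zⁿ`. -/
def HoloGerm.linearForm (g : HoloGerm) : Entire →ₗ[ℂ] ℂ where
  toFun b := ∑' n, g.coeff n * taylorCoeff b n
  map_add' b c := by
    rw [← (g.summable_pairing b).tsum_add (g.summable_pairing c)]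
    refine tsum_congr fun n => ?_
    rw [← mul_add]
    exact congrArg _ (taylorCoeff_add b.analyticAt c.analyticAt n)
  map_smul' c b := by
    rw [RingHom.id_apply, smul_eq_mul, ← tsum_mul_left]
    refine tsum_congr fun n => ?_
    rw [mul_left_comm]
    exact congrArg _ (taylorCoeff_smul b.analyticAt c n)

/-- The continuous linear form `∑ bₙ zⁿ ↦ ∑ aₙ bₙ` on `H(ℂ)` defined by the germ `∑ aₙ zⁿ`. -/
def HoloGerm.functional (g : HoloGerm) : StrongDual ℂ Entire where
  toLinearMap := g.linearForm
  cont := by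
    obtain ⟨C, p, hC, h⟩ := g.exists_bound
    refine withSeminorms_hardyFamily.continuous_normedSpace_rng ℂ g.linearForm ⟨{p + 1}, ⟨2 * C, by positivity⟩, fun b => ?_⟩
    rw [Finset.sup_singleton]
    have h1 := tsum_of_norm_bounded
      (((hasSum_geometric_of_lt_one (by norm_num) (by norm_num)).mul_left _))
      (HoloGerm.norm_pairing_le hC h b)
    refine h1.trans_eq ?_
    change _ = 2 * C * hardyNorm (p + 1) b
    norm_num
    ring

theorem HoloGerm.functional_apply (g : HoloGerm) (b : Entire) :
    g.functional b = ∑' n, g.coeff n * taylorCoeff b n := rfl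

theorem HoloGerm.functional_monomial (g : HoloGerm) (n : ℕ) :
    g.functional (monomial n) = g.coeff n := by
  rw [HoloGerm.functional_apply, tsum_eq_single n]
  · simp [taylorCoeff_monomial]
  · intro m hm
    simp [taylorCoeff_monomial, hm]

/-- Each continuous functional on `H(ℂ)` comes from a germ. -/
theorem HoloGerm.functional_surjective : Function.Surjective HoloGerm.functional := by
  intro φ
  obtain ⟨s, C, hC, hb⟩ := Seminorm.bound_of_continuous withSeminorms_hardyFamily
    ((normSeminorm ℂ ℂ).comp φ.toLinearMap) (continuous_norm.comp φ.continuous)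
  obtain ⟨P, hP⟩ := s.exists_le
  have hφ : ∀ n, ‖φ (monomial n)‖ ≤ C * 2 ^ P * (2 ^ P) ^ n := fun n => by
    have h1 : ‖φ (monomial n)‖ ≤ C * (s.sup hardyFamily) (monomial n) := hb (monomial n)
    refine h1.trans ?_
    rw [mul_assoc]
    refine mul_le_mul_of_nonneg_left ?_ C.2
    refine Seminorm.finset_sup_apply_le (by positivity) fun p hp => ?_
    refine (hardyNorm_monomial_le p n).trans ?_
    have : (2 : ℝ) ^ p ≤ 2 ^ P := pow_le_pow_right₀ (by norm_num) (hP p hp)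
    gcongr
  set F := FormalMultilinearSeries.ofScalars ℂ (fun n => φ (monomial n)) with hF
  have hrad : 0 < F.radius := by
    refine lt_of_lt_of_le ?_ (F.le_radius_of_bound (C * 2 ^ P) (r := (2 ^ P)⁻¹) fun n => ?_)
    · rw [ENNReal.coe_pos]; positivity
    · rw [FormalMultilinearSeries.norm_apply_eq_norm_coef, hF,
        FormalMultilinearSeries.coeff_ofScalars]
      push_cast
      rw [inv_pow, ← div_eq_mul_inv, div_le_iff₀ (by positivity)]
      exact hφ n
  have hS := (F.hasFPowerSeriesOnBall hrad).hasFPowerSeriesAt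
  refine ⟨HoloGerm.mk F.sum hS.analyticAt, ContinuousLinearMap.ext fun b => ?_⟩
  have hc : ∀ n, (HoloGerm.mk F.sum hS.analyticAt).coeff n = φ (monomial n) := fun n => by
    rw [HoloGerm.coeff_mk, taylorCoeff_eq hS, hF, FormalMultilinearSeries.coeff_ofScalars]
  have h1 := ((HoloGerm.mk F.sum hS.analyticAt).summable_pairing b).hasSum.tendsto_sum_nat
  have h2 := (φ.continuous.tendsto b).comp (tendsto_taylor b)
  refine tendsto_nhds_unique h1 (h2.congr fun N => ?_)
  simp only [Function.comp, map_sum, map_smul, smul_eq_mul, hc]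
  exact Finset.sum_congr rfl fun n _ => mul_comm _ _

/-- The identification of the space of germs of holomorphic functions at `0` with the dual of
`H(ℂ)`: the germ `∑ aₙ zⁿ` is identified with the functional `∑ bₙ zⁿ ↦ ∑ aₙ bₙ`. -/
def germEquivDual : HoloGerm ≃ₗ[ℂ] StrongDual ℂ Entire :=
  LinearEquiv.ofBijective
    { toFun := HoloGerm.functional
      map_add' := fun g h => ContinuousLinearMap.ext fun b => by
        change (g + h).functional b = g.functional b + h.functional b
        simp only [HoloGerm.functional_apply]
        rw [← (g.summable_pairing b).tsum_add (h.summable_pairing b)]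
        exact tsum_congr fun n => by rw [HoloGerm.coeff_add, add_mul]
      map_smul' := fun c g => ContinuousLinearMap.ext fun b => by
        change (c • g).functional b = c * g.functional b
        simp only [HoloGerm.functional_apply]
        rw [← tsum_mul_left]
        exact tsum_congr fun n => by rw [HoloGerm.coeff_smul, mul_assoc] }
    ⟨fun g h hgh => HoloGerm.ext_coeff fun n => by
        rw [← HoloGerm.functional_monomial, ← HoloGerm.functional_monomial]
        exact DFunLike.congr_fun hgh (monomial n),
      HoloGerm.functional_surjective⟩

/-- The topology of `H'(ℂ)`: the strong topology of the dual of `H(ℂ)`, that is, the topology of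
uniform convergence on the bounded subsets of `H(ℂ)`. -/
instance : TopologicalSpace HoloGerm :=
  TopologicalSpace.induced germEquivDual inferInstance

end HolGerm

end

/-! Everything is read off from Taylor coefficients. Call a nonnegative sequence `w` a weight if `w
n * R ^ n` is bounded for every `R` of the form `2 ^ p`. By Cauchy's estimate the coefficients of a
bounded set of entire functions are dominated by a weight; conversely, the polynomials whose
coefficients are dominated by a weight form a bounded set. Taking polars, the strong topology on
germs is defined by the weighted `ℓ¹` seminorms `∑ |aₙ| wₙ` (`withSeminorms_weightedSeminorm`).

The algebra statements follow because every weight lies below a submultiplicative one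
(`Weight.exists_submultiplicative`), whose seminorm is then submultiplicative for the Cauchy
product. So the topology is given by submultiplicative seminorms, and continuity of product and
inverse is the usual normed-algebra estimate. A germ is a unit exactly when its value at `0` is
nonzero, and this value is a continuous linear form, so the units form an open set.

For nuclearity, the monomials act as an absolute basis. If `p ≤ C ∑ |aₙ| wₙ`, pass to a strictly
positive weight `v` with `vₙ ≥ 2 ^ n wₙ`: in `∑ aₙ zⁿ` the coefficient forms have size at most `1 /
vₙ` and `p (zⁿ) ≤ C wₙ`, so the products are summable. -/

noncomputable section

namespace HolGerm

/-! ## Weights and weighted `ℓ¹` seminorms on germs -/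

/-- A nonnegative sequence that decreases faster than every geometric sequence. -/
structure Weight where
  /-- The underlying sequence. -/
  seq : ℕ → ℝ
  nonneg : ∀ n, 0 ≤ seq n
  exists_bound : ∀ p : ℕ, ∃ C, ∀ n, seq n * (2 ^ p) ^ n ≤ C

namespace Weight

theorem exists_le (w : Weight) (p : ℕ) : ∃ C, 0 ≤ C ∧ ∀ n, w.seq n ≤ C * ((2 ^ p)⁻¹) ^ n := by
  obtain ⟨C, hC⟩ := w.exists_bound p
  refine ⟨C, ?_, fun n => ?_⟩
  · have := hC 0
    have h0 := w.nonneg 0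
    simp only [pow_zero, mul_one] at this
    linarith
  · rw [inv_pow, ← div_eq_mul_inv, le_div_iff₀ (by positivity)]
    exact hC n

theorem of_le_geometric_bound {u : ℕ → ℝ} {p : ℕ} {C : ℝ} (h : ∀ n, u n ≤ C * ((2 ^ p)⁻¹) ^ n)
    (n : ℕ) : u n * (2 ^ p) ^ n ≤ C := by
  have := h n
  rwa [inv_pow, ← div_eq_mul_inv, le_div_iff₀ (by positivity)] at this

/-- Decay at the next rate `2 ^ (p + 1)` leaves a geometric series of ratio `1 / 2`. -/
theorem summable_mul_pow (w : Weight) (p : ℕ) : Summable fun n => w.seq n * (2 ^ p) ^ n := by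
  obtain ⟨C, -, hC⟩ := w.exists_le (p + 1)
  refine Summable.of_nonneg_of_le (fun n => mul_nonneg (w.nonneg n) (by positivity)) (fun n => ?_)
    ((summable_geometric_of_lt_one (r := (1 / 2 : ℝ)) (by norm_num) (by norm_num)).mul_left C)
  refine (mul_le_mul_of_nonneg_right (hC n) (by positivity)).trans_eq ?_
  rw [mul_assoc, ← mul_pow]
  congr 2
  field_simp
  ring

/-- The sum of two weights. -/
def add (w v : Weight) : Weight where
  seq n := w.seq n + v.seq n
  nonneg n := add_nonneg (w.nonneg n) (v.nonneg n)
  exists_bound p := by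
    obtain ⟨C, hC⟩ := w.exists_bound p
    obtain ⟨D, hD⟩ := v.exists_bound p
    exact ⟨C + D, fun n => by rw [add_mul]; exact add_le_add (hC n) (hD n)⟩

/-- The weight `2ⁿ wₙ`. -/
def dilate (w : Weight) : Weight where
  seq n := 2 ^ n * w.seq n
  nonneg n := mul_nonneg (by positivity) (w.nonneg n)
  exists_bound p := by
    -- The extra factor `2 ^ n` is absorbed by using the bound at the rate `2 ^ (p + 1)`.
    obtain ⟨C, hC⟩ := w.exists_bound (p + 1)
    refine ⟨C, fun n => (hC n).trans_eq' ?_⟩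
    rw [pow_succ, mul_pow]
    ring

/-- The weight `1 / n!`. -/
def invFactorial : Weight where
  seq n := (n.factorial : ℝ)⁻¹
  nonneg n := by positivity
  exists_bound p := by
    refine ⟨Real.exp (2 ^ p), fun n => ?_⟩
    have := Real.pow_div_factorial_le_exp (2 ^ p : ℝ) (by positivity) n
    rwa [div_eq_inv_mul] at this

/-- The weight that is `1` at `m` and `0` elsewhere. -/
def single (m : ℕ) : Weight where
  seq n := if n = m then 1 else 0
  nonneg n := by split_ifs <;> norm_num
  exists_bound p := by
    refine ⟨(2 ^ p) ^ m, fun n => ?_⟩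
    split_ifs with h
    · rw [h, one_mul]
    · rw [zero_mul]; positivity

/-- Every weight is dominated by a submultiplicative one. -/
theorem exists_submultiplicative (w : Weight) :
    ∃ v : Weight, (∀ n, w.seq n ≤ v.seq n) ∧ ∀ i j, v.seq (i + j) ≤ v.seq i * v.seq j := by
  choose C hC0 hC using w.exists_le
  -- The dominating weight is the infimum over `p` of these geometric bounds. Raising the constants
  -- to at least `1` gives `2 ^ (-p n) ≤ u n p`, which is what lets one factor be split off in
  -- `key`.
  let u : ℕ → ℕ → ℝ := fun n p => max (C p) 1 * ((2 ^ p)⁻¹ : ℝ) ^ n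
  have hu0 : ∀ n p, 0 ≤ u n p := fun n p => by positivity
  have hb : ∀ n, BddBelow (Set.range (u n)) := fun n => ⟨0, by rintro _ ⟨p, rfl⟩; exact hu0 n p⟩
  have key : ∀ i j p q, p ≤ q → u (i + j) q ≤ u i p * u j q := fun i j p q hpq => by
    have h1 : ((2 ^ q)⁻¹ : ℝ) ≤ (2 ^ p)⁻¹ := by
      gcongr
      norm_num
    have h2 : ((2 ^ q)⁻¹ : ℝ) ^ i ≤ max (C p) 1 * ((2 ^ p)⁻¹) ^ i :=
      (pow_le_pow_left₀ (by positivity) h1 i).trans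
        (le_mul_of_one_le_left (by positivity) (le_max_right _ _))
    calc u (i + j) q = ((2 ^ q)⁻¹ : ℝ) ^ i * u j q := by simp only [u, pow_add]; ring
      _ ≤ u i p * u j q := mul_le_mul_of_nonneg_right h2 (hu0 j q)
  refine ⟨⟨fun n => ⨅ p, u n p, fun n => le_ciInf (hu0 n),
    fun p => ⟨max (C p) 1, of_le_geometric_bound fun n => ciInf_le (hb n) p⟩⟩, fun n => ?_,
    fun i j => ?_⟩
  · exact le_ciInf fun p => (hC p n).trans
      (mul_le_mul_of_nonneg_right (le_max_left _ _) (by positivity))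
  -- The product of infima is an infimum over pairs `(p, q)`; for each pair the left side is bounded
  -- by its term at the larger index, and the case `q ≤ p` exchanges the roles of `i` and `j`.
  · change ⨅ p, u (i + j) p ≤ (⨅ p, u i p) * ⨅ p, u j p
    rw [Real.iInf_mul_of_nonneg (le_ciInf (hu0 j))]
    refine le_ciInf fun p => ?_
    rw [Real.mul_iInf_of_nonneg (hu0 i p)]
    refine le_ciInf fun q => ?_
    rcases le_total p q with h | h
    · exact (ciInf_le (hb _) q).trans (key i j p q h)
    · refine (ciInf_le (hb _) p).trans ?_
      rw [add_comm, mul_comm]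
      exact key j i q p h

end Weight

/-- The coefficients of a germ grow at some exponential rate, which the weight beats because it
beats all of them. -/
theorem HoloGerm.summable_weight (w : Weight) (g : HoloGerm) :
    Summable fun n => ‖g.coeff n‖ * w.seq n := by
  obtain ⟨C, p, -, hC⟩ := g.exists_bound
  refine Summable.of_nonneg_of_le (fun n => mul_nonneg (norm_nonneg _) (w.nonneg n)) (fun n => ?_)
    ((w.summable_mul_pow p).mul_left C)
  refine (mul_le_mul_of_nonneg_right (hC n) (w.nonneg n)).trans_eq ?_
  ring

/-- The seminorm `∑ |aₙ| wₙ` on germs. -/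
def weightedSeminorm (w : Weight) : Seminorm ℂ HoloGerm :=
  Seminorm.of (fun g => ∑' n, ‖g.coeff n‖ * w.seq n)
    (fun g h => by
      rw [← (g.summable_weight w).tsum_add (h.summable_weight w)]
      refine ((g + h).summable_weight w).tsum_le_tsum (fun n => ?_)
        ((g.summable_weight w).add (h.summable_weight w))
      rw [HoloGerm.coeff_add, ← add_mul]
      exact mul_le_mul_of_nonneg_right (norm_add_le _ _) (w.nonneg n))
    (fun c g => by
      rw [← tsum_mul_left]
      refine tsum_congr fun n => ?_
      rw [HoloGerm.coeff_smul, norm_mul, mul_assoc])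

theorem weightedSeminorm_apply (w : Weight) (g : HoloGerm) :
    weightedSeminorm w g = ∑' n, ‖g.coeff n‖ * w.seq n := rfl

theorem weightedSeminorm_mono {w v : Weight} (h : ∀ n, w.seq n ≤ v.seq n) :
    weightedSeminorm w ≤ weightedSeminorm v := fun g =>
  (g.summable_weight w).tsum_le_tsum
    (fun n => mul_le_mul_of_nonneg_left (h n) (norm_nonneg _)) (g.summable_weight v)

theorem norm_coeff_mul_le (w : Weight) (g : HoloGerm) (n : ℕ) :
    ‖g.coeff n‖ * w.seq n ≤ weightedSeminorm w g :=
  (g.summable_weight w).le_tsum n fun m _ => mul_nonneg (norm_nonneg _) (w.nonneg m)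

theorem weightedSeminorm_single (m : ℕ) (g : HoloGerm) :
    weightedSeminorm (Weight.single m) g = ‖g.coeff m‖ := by
  rw [weightedSeminorm_apply, tsum_eq_single m] <;> simp +contextual [Weight.single]

/-! ## The strong topology is defined by the weighted seminorms -/

instance : IsTopologicalAddGroup HoloGerm := topologicalAddGroup_induced germEquivDual

theorem HoloGerm.functional_sum_monomial (g : HoloGerm) (s : Finset ℕ) (c : ℕ → ℂ) :
    g.functional (∑ n ∈ s, c n • monomial n) = ∑ n ∈ s, c n * g.coeff n := by
  simp only [map_sum, map_smul, smul_eq_mul, HoloGerm.functional_monomial]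

/-- The polynomials with coefficients bounded by a weight form a bounded subset of `H(ℂ)`. -/
theorem isVonNBounded_polynomials (w : Weight) :
    Bornology.IsVonNBounded ℂ {b : Entire | ∃ (s : Finset ℕ) (c : ℕ → ℂ),
      (∀ n, ‖c n‖ ≤ w.seq n) ∧ b = ∑ n ∈ s, c n • monomial n} := by
  rw [withSeminorms_hardyFamily.isVonNBounded_iff_seminorm_bounded]
  intro p
  have hsum := (w.summable_mul_pow p).mul_left (2 ^ p)
  have hnn : ∀ n, 0 ≤ (2 : ℝ) ^ p * (w.seq n * (2 ^ p) ^ n) := fun n =>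
    mul_nonneg (by positivity) (mul_nonneg (w.nonneg n) (by positivity))
  -- The added `1` makes the bound positive and strict, as the criterion demands.
  refine ⟨(∑' n, 2 ^ p * (w.seq n * (2 ^ p) ^ n)) + 1,
    add_pos_of_nonneg_of_pos (tsum_nonneg hnn) one_pos, ?_⟩
  rintro _ ⟨s, c, hc, rfl⟩
  refine lt_of_le_of_lt ?_ (lt_add_one _)
  refine le_trans ?_ (hsum.sum_le_tsum s fun n _ => hnn n)
  refine (Finset.le_sum_of_subadditive (hardyFamily p) (map_zero _).le
    (map_add_le_add _) s _).trans (Finset.sum_le_sum fun n _ => ?_)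
  rw [map_smul_eq_mul]
  refine (mul_le_mul (hc n) (hardyNorm_monomial_le p n) (apply_nonneg (hardyFamily p) _)
    (w.nonneg n)).trans_eq ?_
  ring

/-- Choosing the phases of `c n` to cancel those of the coefficients turns the pairing into a
partial sum of the seminorm, so the polar of these polynomials controls the seminorm. -/
theorem weightedSeminorm_le_of_polynomials (w : Weight) (g : HoloGerm) {ε : ℝ}
    (h : ∀ (s : Finset ℕ) (c : ℕ → ℂ), (∀ n, ‖c n‖ ≤ w.seq n) →
      ‖g.functional (∑ n ∈ s, c n • monomial n)‖ ≤ ε) : weightedSeminorm w g ≤ ε := by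
  refine Real.tsum_le_of_sum_le (fun n => mul_nonneg (norm_nonneg _) (w.nonneg n)) fun s => ?_
  -- If the coefficient vanishes, division by zero gives `c n = 0`, and the required identity still
  -- holds.
  let c : ℕ → ℂ := fun n => w.seq n * ((starRingEnd ℂ) (g.coeff n) / ‖g.coeff n‖)
  have hc : ∀ n, ‖c n‖ ≤ w.seq n := fun n => by
    simp only [c, norm_mul, norm_div, Complex.norm_real, norm_norm, RCLike.norm_conj,
      Real.norm_of_nonneg (w.nonneg n)]
    exact mul_le_of_le_one_right (w.nonneg n) (div_self_le_one _)
  have h1 := h s c hc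
  rw [HoloGerm.functional_sum_monomial] at h1
  have h2 : ∀ n, c n * g.coeff n = ((‖g.coeff n‖ * w.seq n : ℝ) : ℂ) := fun n => by
    by_cases h0 : g.coeff n = 0
    · simp [h0]
    · have h3 : ((‖g.coeff n‖ : ℝ) : ℂ) ≠ 0 := by simpa using h0
      have h4 := Complex.conj_mul' (g.coeff n)
      simp only [c]
      push_cast
      field_simp
      rw [mul_assoc, h4]
  simp only [h2] at h1
  rw [← Complex.ofReal_sum, Complex.norm_real] at h1
  exact (le_abs_self _).trans h1

/-- The suprema of the Taylor coefficients over a bounded set of entire functions. -/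
theorem exists_weight_of_isVonNBounded {S : Set Entire} (hS : Bornology.IsVonNBounded ℂ S) :
    ∃ w : Weight, ∀ b ∈ S, ∀ n, ‖taylorCoeff b n‖ ≤ w.seq n := by
  rw [withSeminorms_hardyFamily.isVonNBounded_iff_seminorm_bounded] at hS
  choose r hr0 hr using hS
  have hle : ∀ b ∈ S, ∀ p n, ‖taylorCoeff b n‖ ≤ r p * ((2 ^ p)⁻¹) ^ n := fun b hb p n =>
    (norm_taylorCoeff_le b p n).trans
      (mul_le_mul_of_nonneg_right (hr p b hb).le (by positivity))
  -- If `S` is empty the real supremum is `0`, so the upper bounds are also required to be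
  -- nonnegative.
  refine ⟨⟨fun n => ⨆ b : S, ‖taylorCoeff b.1 n‖,
    fun n => Real.iSup_nonneg fun _ => norm_nonneg _,
    fun p => ⟨r p, Weight.of_le_geometric_bound fun n => ?_⟩⟩, fun b hb n => ?_⟩
  · exact Real.iSup_le (fun b => hle b.1 b.2 p n)
      (mul_nonneg (hr0 p).le (by positivity))
  · refine le_ciSup (f := fun b : S => ‖taylorCoeff b.1 n‖) ⟨r 0 * ((2 ^ 0)⁻¹) ^ n, ?_⟩ ⟨b, hb⟩
    rintro _ ⟨c, rfl⟩
    exact hle c.1 c.2 0 n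

theorem norm_functional_le {w : Weight} {b : Entire} (h : ∀ n, ‖taylorCoeff b n‖ ≤ w.seq n)
    (g : HoloGerm) : ‖g.functional b‖ ≤ weightedSeminorm w g :=
  tsum_of_norm_bounded (g.summable_weight w).hasSum fun n => by
    rw [norm_mul]
    exact mul_le_mul_of_nonneg_left (h n) (norm_nonneg _)

/-- Two families of neighbourhoods of `0` are compared: each seminorm ball contains the polar of a
bounded set of polynomials, and each polar of a bounded set contains a ball for the weight
dominating its Taylor coefficients. -/
theorem withSeminorms_weightedSeminorm : WithSeminorms weightedSeminorm := by
  rw [SeminormFamily.withSeminorms_iff_nhds_eq_iInf, nhds_induced, map_zero]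
  have hB := (ContinuousLinearMap.hasBasis_nhds_zero_of_basis (σ := RingHom.id ℂ) (E := Entire)
    (Metric.nhds_basis_closedBall (x := (0 : ℂ)))).comap germEquivDual
  refine le_antisymm (le_iInf fun w => ?_) ?_
  · rw [← tendsto_iff_comap, Metric.nhds_basis_closedBall.tendsto_right_iff]
    intro ε hε
    filter_upwards [hB.mem_of_mem (i := (_, ε)) ⟨isVonNBounded_polynomials w, hε⟩] with g hg
    rw [mem_closedBall_zero_iff, Real.norm_of_nonneg (apply_nonneg _ _)]
    refine weightedSeminorm_le_of_polynomials w g fun s c hc => ?_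
    exact mem_closedBall_zero_iff.mp (hg _ ⟨s, c, hc, rfl⟩)
  · rw [hB.ge_iff]
    rintro ⟨S, ε⟩ ⟨hS, hε⟩
    obtain ⟨w, hw⟩ := exists_weight_of_isVonNBounded hS
    refine mem_iInf_of_mem w ⟨Metric.closedBall 0 ε, Metric.closedBall_mem_nhds _ hε, ?_⟩
    intro g hg b hb
    have hg' : weightedSeminorm w g ≤ ε :=
      (le_abs_self _).trans (mem_closedBall_zero_iff.mp hg)
    exact mem_closedBall_zero_iff.mpr ((norm_functional_le (hw b hb) g).trans hg')

instance : ContinuousSMul ℂ HoloGerm := withSeminorms_weightedSeminorm.continuousSMul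

theorem continuous_weightedSeminorm (w : Weight) : Continuous (weightedSeminorm w) :=
  withSeminorms_weightedSeminorm.continuous_seminorm w

/-- The Taylor coefficients as linear forms. -/
def coeffLinear (n : ℕ) : HoloGerm →ₗ[ℂ] ℂ where
  toFun g := g.coeff n
  map_add' g h := HoloGerm.coeff_add g h n
  map_smul' c g := HoloGerm.coeff_smul c g n

theorem HoloGerm.continuous_coeff (n : ℕ) : Continuous fun g : HoloGerm => g.coeff n := by
  refine withSeminorms_weightedSeminorm.continuous_normedSpace_rng ℂ (coeffLinear n)
    ⟨{Weight.single n}, 1, fun g => ?_⟩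
  rw [Finset.sup_singleton, one_smul]
  exact (weightedSeminorm_single n g).ge

instance : T2Space HoloGerm :=
  T2Space.of_injective_continuous (f := fun g n => g.coeff n)
    (fun _ _ h => HoloGerm.ext_coeff fun n => congrFun h n)
    (continuous_pi HoloGerm.continuous_coeff)

/-- A continuous seminorm on the space of germs is dominated by a weighted one. -/
theorem exists_weightedSeminorm_ge (p : Seminorm ℂ HoloGerm) (hp : Continuous p) :
    ∃ (w : Weight) (C : ℝ), 0 ≤ C ∧ ∀ g, p g ≤ C * weightedSeminorm w g := by
  obtain ⟨s, C, -, hC⟩ := Seminorm.bound_of_continuous withSeminorms_weightedSeminorm p hp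
  -- The family is directed, since a sum of weights dominates both summands; hence one weight
  -- replaces the finite supremum.
  have hs : ∃ w : Weight, ∀ g, (s.sup weightedSeminorm) g ≤ weightedSeminorm w g := by
    clear hC
    classical
    induction s using Finset.induction_on with
    | empty => exact ⟨Weight.single 0, fun g => by simp⟩
    | insert a s _ ih =>
      obtain ⟨w, hw⟩ := ih
      refine ⟨a.add w, fun g => ?_⟩
      rw [Finset.sup_insert]
      refine sup_le ?_ ((hw g).trans ?_)
      · exact weightedSeminorm_mono (v := a.add w) (fun n => le_add_of_nonneg_right (w.nonneg n)) g
      · exact weightedSeminorm_mono (v := a.add w) (fun n => le_add_of_nonneg_left (a.nonneg n)) g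
  obtain ⟨w, hw⟩ := hs
  exact ⟨w, C, C.2, fun g => (hC g).trans (mul_le_mul_of_nonneg_left (hw g) C.2)⟩

end HolGerm

namespace HolGerm

/-! ## Multiplication and inversion of germs -/

/-- This is Leibniz's rule divided by `n!`, which turns the binomial coefficients into the two
inverse factorials. -/
theorem taylorCoeff_mul {f g : ℂ → ℂ} (hf : AnalyticAt ℂ f 0) (hg : AnalyticAt ℂ g 0) (n : ℕ) :
    taylorCoeff (f * g) n =
      ∑ ij ∈ Finset.HasAntidiagonal.antidiagonal n, taylorCoeff f ij.1 * taylorCoeff g ij.2 := by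
  rw [taylorCoeff, iteratedDeriv_mul hf.contDiffAt hg.contDiffAt,
    Finset.Nat.sum_antidiagonal_eq_sum_range_succ (fun i j => taylorCoeff f i * taylorCoeff g j),
    Finset.sum_div]
  refine Finset.sum_congr rfl fun i hi => ?_
  have hin : i ≤ n := Nat.lt_succ_iff.mp (Finset.mem_range.mp hi)
  rw [taylorCoeff, taylorCoeff, Nat.cast_choose ℂ hin]
  have h1 : (n.factorial : ℂ) ≠ 0 := Nat.cast_ne_zero.mpr n.factorial_ne_zero
  field_simp

theorem HoloGerm.coeff_mul (g h : HoloGerm) (n : ℕ) :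
    (g * h).coeff n = ∑ ij ∈ Finset.HasAntidiagonal.antidiagonal n, g.coeff ij.1 * h.coeff ij.2 := by
  obtain ⟨f, hf, rfl⟩ := g.exists_rep
  obtain ⟨k, hk, rfl⟩ := h.exists_rep
  exact taylorCoeff_mul hf hk n

/-- The right side is the antidiagonal sum of two absolutely convergent series; it dominates term by
term because `v (i + j) ≤ v i * v j`. -/
theorem weightedSeminorm_mul_le {v : Weight} (hv : ∀ i j, v.seq (i + j) ≤ v.seq i * v.seq j)
    (g h : HoloGerm) :
    weightedSeminorm v (g * h) ≤ weightedSeminorm v g * weightedSeminorm v h := by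
  have hn : ∀ (k : HoloGerm) n, ‖‖k.coeff n‖ * v.seq n‖ = ‖k.coeff n‖ * v.seq n := fun k n =>
    Real.norm_of_nonneg (mul_nonneg (norm_nonneg _) (v.nonneg n))
  have hg : Summable fun n => ‖‖g.coeff n‖ * v.seq n‖ := by simpa only [hn] using g.summable_weight v
  have hh : Summable fun n => ‖‖h.coeff n‖ * v.seq n‖ := by simpa only [hn] using h.summable_weight v
  simp only [weightedSeminorm_apply]
  rw [tsum_mul_tsum_eq_tsum_sum_antidiagonal_of_summable_norm hg hh]
  refine ((g * h).summable_weight v).tsum_le_tsum (fun n => ?_)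
    (summable_norm_sum_mul_antidiagonal_of_summable_norm hg hh).of_norm
  rw [HoloGerm.coeff_mul]
  refine (mul_le_mul_of_nonneg_right (norm_sum_le _ _) (v.nonneg n)).trans ?_
  rw [Finset.sum_mul]
  refine Finset.sum_le_sum fun ij hij => ?_
  rw [norm_mul, mul_mul_mul_comm, ← Finset.HasAntidiagonal.mem_antidiagonal.mp hij]
  exact mul_le_mul_of_nonneg_left (hv _ _) (by positivity)

/-- Local multiplicative convexity, the only input on the topology for the two continuity proofs
below apart from the weighted seminorms defining it. -/
theorem exists_submultiplicative_seminorm (w : Weight) : ∃ q : Seminorm ℂ HoloGerm,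
    Continuous q ∧ weightedSeminorm w ≤ q ∧ ∀ g h, q (g * h) ≤ q g * q h := by
  obtain ⟨v, hwv, hv⟩ := w.exists_submultiplicative
  exact ⟨weightedSeminorm v, continuous_weightedSeminorm v, weightedSeminorm_mono hwv,
    weightedSeminorm_mul_le hv⟩

instance : ContinuousMul HoloGerm where
  continuous_mul := by
    rw [continuous_iff_continuousAt]
    rintro ⟨a, b⟩
    rw [ContinuousAt, withSeminorms_weightedSeminorm.tendsto_nhds]
    intro w ε hε
    obtain ⟨q, hq, hwq, hmul⟩ := exists_submultiplicative_seminorm w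
    -- This majorant of `q (x.1 * x.2 - a * b)` vanishes at `(a, b)`; it comes from `xy - ab = (x -
    -- a) y + a (y - b)`.
    have hc : Continuous fun x : HoloGerm × HoloGerm =>
        q (x.1 - a) * q x.2 + q a * q (x.2 - b) := by fun_prop
    filter_upwards [(hc.tendsto (a, b)).eventually_lt_const (u := ε) (by simpa using hε)] with x hx
    refine lt_of_le_of_lt ?_ hx
    have h1 : x.1 * x.2 - a * b = (x.1 - a) * x.2 + a * (x.2 - b) := by ring
    rw [h1]
    exact (hwq _).trans ((map_add_le_add q _ _).trans (add_le_add (hmul _ _) (hmul _ _)))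

instance : IsTopologicalRing HoloGerm where

theorem HoloGerm.isUnit_iff (g : HoloGerm) : IsUnit g ↔ g.valueAtZero ≠ 0 := by
  obtain ⟨f, hf, rfl⟩ := g.exists_rep
  change _ ↔ f 0 ≠ 0
  constructor
  · intro h h0
    obtain ⟨k, hk⟩ := h.exists_right_inv
    obtain ⟨k, hk', rfl⟩ := k.exists_rep
    have h1 : f 0 * k 0 = 1 := congrArg HoloGerm.valueAtZero hk
    simp [h0] at h1
  · intro h0
    refine IsUnit.of_mul_eq_one (HoloGerm.mk f⁻¹ (hf.inv h0)) (Subtype.ext ?_)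
    refine Filter.Germ.coe_eq.mpr ?_
    filter_upwards [hf.continuousAt.eventually_ne h0] with z hz
    exact mul_inv_cancel₀ hz

theorem HoloGerm.coeff_zero (g : HoloGerm) : g.coeff 0 = g.valueAtZero := by
  obtain ⟨f, hf, rfl⟩ := g.exists_rep
  rw [HoloGerm.coeff_mk, taylorCoeff, iteratedDeriv_zero, Nat.factorial_zero, Nat.cast_one, div_one]
  rfl

theorem HoloGerm.isOpen_setOf_isUnit : IsOpen {g : HoloGerm | IsUnit g} := by
  simp only [HoloGerm.isUnit_iff, ← HoloGerm.coeff_zero]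
  exact isOpen_ne_fun (HoloGerm.continuous_coeff 0) continuous_const

/-- The identity `x⁻¹ - a⁻¹ = x⁻¹ (a - x) a⁻¹` suffices once `x⁻¹` is bounded near `a`. Since `x` is
already a unit, no Neumann series and no completeness are needed. -/
theorem HoloGerm.continuousOn_inverse :
    ContinuousOn (fun g : HoloGerm => Ring.inverse g) {g : HoloGerm | IsUnit g} := by
  intro a ha
  rw [ContinuousWithinAt, withSeminorms_weightedSeminorm.tendsto_nhds]
  intro w ε hε
  obtain ⟨q, hq, hwq, hmul⟩ := exists_submultiplicative_seminorm w
  set A := q (Ring.inverse a) with hA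
  have hA0 : 0 ≤ A := apply_nonneg q _
  have hc : Continuous fun x : HoloGerm => q (a - x) * A := by fun_prop
  have hc' : Continuous fun x : HoloGerm => 2 * A * q (a - x) * A := by fun_prop
  filter_upwards [self_mem_nhdsWithin,
    nhdsWithin_le_nhds ((hc.tendsto a).eventually_lt_const (u := 1 / 2) (by simp)),
    nhdsWithin_le_nhds ((hc'.tendsto a).eventually_lt_const (u := ε) (by simpa using hε))] with x hx h1 h2
  have hax : Ring.inverse x - Ring.inverse a = Ring.inverse x * (a - x) * Ring.inverse a := by
    linear_combination Ring.inverse a * Ring.mul_inverse_cancel x hx -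
      Ring.inverse x * Ring.mul_inverse_cancel a ha
  have hX0 : 0 ≤ q (Ring.inverse x) := apply_nonneg q _
  have hle : q (Ring.inverse x - Ring.inverse a) ≤ q (Ring.inverse x) * (q (a - x) * A) := by
    rw [hax, ← mul_assoc]
    exact (hmul _ _).trans (mul_le_mul_of_nonneg_right (hmul _ _) hA0)
  -- As `q (a - x) * A < 1 / 2`, the difference is at most `q (x⁻¹) / 2`, which is absorbed into the
  -- left side.
  have hX : q (Ring.inverse x) ≤ 2 * A := by
    have h3 : q (Ring.inverse x) ≤ q (Ring.inverse x - Ring.inverse a) + A := by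
      simpa using map_add_le_add q (Ring.inverse x - Ring.inverse a) (Ring.inverse a)
    have h4 := mul_le_mul_of_nonneg_left h1.le hX0
    linarith
  refine (hwq _).trans_lt (hle.trans_lt (lt_of_le_of_lt ?_ h2))
  rw [mul_assoc (2 * A)]
  exact mul_le_mul_of_nonneg_right hX (mul_nonneg (apply_nonneg q _) hA0)

/-! ## Nuclearity -/

/-- The germ of `z ↦ zⁿ`. -/
def monomialGerm (n : ℕ) : HoloGerm := HoloGerm.mk (monomial n) (monomial n).analyticAt

theorem coeff_monomialGerm (n m : ℕ) : (monomialGerm n).coeff m = if m = n then 1 else 0 :=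
  taylorCoeff_monomial n m

theorem weightedSeminorm_monomialGerm (w : Weight) (n : ℕ) :
    weightedSeminorm w (monomialGerm n) = w.seq n := by
  rw [weightedSeminorm_apply, tsum_eq_single n] <;> simp +contextual [coeff_monomialGerm]

theorem HoloGerm.coeff_sum_monomialGerm (g : HoloGerm) (N m : ℕ) :
    (∑ n ∈ Finset.range N, g.coeff n • monomialGerm n).coeff m =
      if m < N then g.coeff m else 0 := by
  have h : ∀ s : Finset ℕ, (∑ n ∈ s, g.coeff n • monomialGerm n).coeff m =
      ∑ n ∈ s, g.coeff n * (monomialGerm n).coeff m := by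
    intro s
    induction s using Finset.induction_on with
    | empty => simpa using HoloGerm.coeff_smul 0 0 m
    | insert a s ha ih =>
      rw [Finset.sum_insert ha, Finset.sum_insert ha, HoloGerm.coeff_add, HoloGerm.coeff_smul, ih]
  rw [h]
  simp [coeff_monomialGerm]

/-- The Taylor series of a germ converges to it. -/
theorem HoloGerm.tendsto_taylor (g : HoloGerm) :
    Tendsto (fun N => ∑ n ∈ Finset.range N, g.coeff n • monomialGerm n) atTop (𝓝 g) := by
  rw [withSeminorms_weightedSeminorm.tendsto_nhds]
  intro w ε hε
  -- The seminorm of the remainder is exactly the tail of the convergent series defining the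
  -- seminorm of `g`.
  have h := (tendsto_sum_nat_add fun n => ‖g.coeff n‖ * w.seq n).eventually_lt_const hε
  filter_upwards [h] with N hN
  refine lt_of_eq_of_lt ?_ hN
  rw [← map_sub_rev, weightedSeminorm_apply]
  have hc : ∀ n, (g - ∑ n ∈ Finset.range N, g.coeff n • monomialGerm n).coeff n =
      if n < N then 0 else g.coeff n := fun n => by
    rw [eq_sub_of_add_eq ((HoloGerm.coeff_add _ _ n).symm.trans
      (congrArg (fun k : HoloGerm => k.coeff n) (sub_add_cancel g _))),
      HoloGerm.coeff_sum_monomialGerm]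
    split_ifs <;> simp
  have hs := (g - ∑ n ∈ Finset.range N, g.coeff n • monomialGerm n).summable_weight w
  rw [← hs.sum_add_tsum_nat_add N, Finset.sum_eq_zero, zero_add]
  · refine tsum_congr fun n => ?_
    rw [hc, if_neg (by omega)]
  · intro n hn
    rw [hc, if_pos (Finset.mem_range.mp hn), norm_zero, zero_mul]

end HolGerm

/-! ### Nuclearity from series expansions -/

namespace NuclearDef

variable {E : Type*} [AddCommGroup E] [Module ℂ E]

/-- The canonical map to the local Banach space as a linear map. -/
def toLocalBanachLinear (p : Seminorm ℂ E) : E →ₗ[ℂ] LocalBanach p :=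
  (UniformSpace.Completion.toComplL (𝕜 := ℂ) (E := SeminormSpace p)).toLinearMap

theorem toLocalBanachLinear_apply (p : Seminorm ℂ E) (x : E) :
    toLocalBanachLinear p x = toLocalBanach p x := rfl

theorem norm_toLocalBanach (p : Seminorm ℂ E) (x : E) : ‖toLocalBanach p x‖ = p x :=
  UniformSpace.Completion.norm_coe (E := SeminormSpace p) x

theorem denseRange_toLocalBanach (p : Seminorm ℂ E) : DenseRange (toLocalBanachLinear p) :=
  UniformSpace.Completion.denseRange_coe (α := SeminormSpace p)

/-- A linear form bounded by `c q` extends to the Banach space attached to `q`. -/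
theorem exists_extension (q : Seminorm ℂ E) (f : E →ₗ[ℂ] ℂ) {c : ℝ} (hc : 0 ≤ c)
    (h : ∀ x, ‖f x‖ ≤ c * q x) :
    ∃ φ : LocalBanach q →L[ℂ] ℂ, ‖φ‖ ≤ c ∧ ∀ x, φ (toLocalBanach q x) = f x := by
  have h' : ∀ x, ‖f x‖ ≤ c * ‖toLocalBanachLinear q x‖ := fun x => by
    rw [toLocalBanachLinear_apply, norm_toLocalBanach]; exact h x
  exact ⟨f.extendOfNorm (toLocalBanachLinear q),
    LinearMap.opNorm_extendOfNorm_le (denseRange_toLocalBanach q) hc h',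
    LinearMap.extendOfNorm_eq (denseRange_toLocalBanach q) ⟨c, h'⟩⟩

/-- If every `x` is the sum of a series `∑ fₙ(x) eₙ` with respect to `p`, where `|fₙ| ≤ cₙ q` and
`∑ cₙ p(eₙ) < ∞`, then the canonical map from the completion for `q` to that for `p` is nuclear. -/
theorem exists_nuclear_of_expansion (p q : Seminorm ℂ E) (f : ℕ → E →ₗ[ℂ] ℂ) (e : ℕ → E)
    (c : ℕ → ℝ) (hc : ∀ n, 0 ≤ c n) (hf : ∀ n x, ‖f n x‖ ≤ c n * q x)
    (hs : Summable fun n => c n * p (e n))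
    (hx : ∀ x, Tendsto (fun N => p (∑ n ∈ Finset.range N, f n x • e n - x)) atTop (𝓝 0)) :
    ∃ T : LocalBanach q →L[ℂ] LocalBanach p,
      (∀ x : E, T (toLocalBanach q x) = toLocalBanach p x) ∧ IsNuclearOperator T := by
  choose φ hφ hφe using fun n => exists_extension q (f n) (hc n) (hf n)
  let y : ℕ → LocalBanach p := fun n => toLocalBanachLinear p (e n)
  have hy : ∀ n, ‖y n‖ = p (e n) := fun n => norm_toLocalBanach p (e n)
  have hsum : Summable fun n => ‖φ n‖ * ‖y n‖ :=
    Summable.of_nonneg_of_le (fun n => by positivity)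
      (fun n => by
        rw [hy]
        exact mul_le_mul_of_nonneg_right (hφ n) (apply_nonneg p _)) hs
  -- The rank-one operators are absolutely summable in operator norm, so their sum is a bounded
  -- operator.
  have hT : Summable fun n => (φ n).smulRight (y n) :=
    Summable.of_norm (by simpa only [ContinuousLinearMap.norm_smulRight_apply] using hsum)
  have hTx : ∀ x, HasSum (fun n => φ n x • y n) ((∑' n, (φ n).smulRight (y n)) x) := fun x => by
    simpa using hT.hasSum.mapL (ContinuousLinearMap.apply ℂ (LocalBanach p) x)
  refine ⟨∑' n, (φ n).smulRight (y n), fun x => ?_, φ, y, hsum, hTx⟩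
  -- On the image of `E` the partial sums tend both to the value of the operator and, by `hx`, to
  -- the canonical image of `x`.
  refine tendsto_nhds_unique (hTx (toLocalBanach q x)).tendsto_sum_nat ?_
  rw [tendsto_iff_norm_sub_tendsto_zero]
  refine (hx x).congr fun N => ?_
  rw [← norm_toLocalBanach, ← toLocalBanachLinear_apply, map_sub, map_sum]
  simp only [map_smul, hφe]
  rfl

end NuclearDef

namespace HolGerm

theorem isNuclearSpace_holoGerm : NuclearDef.IsNuclearSpace HoloGerm where
  isTopologicalAddGroup := inferInstance
  continuousSMul := inferInstance
  locallyConvexSpace := withSeminorms_weightedSeminorm.toLocallyConvexSpace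
  t2Space := inferInstance
  exists_nuclear p hp := by
    obtain ⟨w, C, hC, hpw⟩ := exists_weightedSeminorm_ge p hp
    -- The summand `1 / n!` makes `v` strictly positive, so that one can divide by it; the dilation
    -- by `2 ^ n` supplies the summability.
    let v : Weight := (w.add Weight.invFactorial).dilate
    have hv : ∀ n, 0 < v.seq n := fun n =>
      mul_pos (by positivity) (add_pos_of_nonneg_of_pos (w.nonneg n)
        (inv_pos.mpr (Nat.cast_pos.mpr n.factorial_pos)))
    have hwv : ∀ n, 2 ^ n * w.seq n ≤ v.seq n := fun n =>
      mul_le_mul_of_nonneg_left (le_add_of_nonneg_right (Weight.invFactorial.nonneg n))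
        (by positivity)
    -- Adding `p` secures `p ≤ q` whatever the constant `C` is.
    refine ⟨p + weightedSeminorm v, hp.add (continuous_weightedSeminorm v),
      fun g => le_add_of_nonneg_right (apply_nonneg _ _),
      NuclearDef.exists_nuclear_of_expansion p _ coeffLinear monomialGerm (fun n => (v.seq n)⁻¹)
        (fun n => inv_nonneg.mpr (v.nonneg n)) (fun n g => ?_) ?_ fun g => ?_⟩
    · rw [← div_eq_inv_mul, le_div_iff₀ (hv n)]
      exact (norm_coeff_mul_le v g n).trans (le_add_of_nonneg_left (apply_nonneg p g))
    · refine Summable.of_nonneg_of_le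
        (fun n => mul_nonneg (inv_nonneg.mpr (v.nonneg n)) (apply_nonneg p _)) (fun n => ?_)
        ((summable_geometric_of_lt_one (r := (1 / 2 : ℝ)) (by norm_num) (by norm_num)).mul_left C)
      have h1 := hpw (monomialGerm n)
      rw [weightedSeminorm_monomialGerm] at h1
      rw [← div_eq_inv_mul, div_le_iff₀ (hv n)]
      calc p (monomialGerm n) ≤ C * w.seq n := h1
        _ = C * (1 / 2) ^ n * (2 ^ n * w.seq n) := by
          rw [mul_assoc, ← mul_assoc ((1 / 2 : ℝ) ^ n), ← mul_pow]; norm_num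
        _ ≤ C * (1 / 2) ^ n * v.seq n := mul_le_mul_of_nonneg_left (hwv n) (by positivity)
    · have h := (hp.comp (continuous_sub_right g)).tendsto g |>.comp g.tendsto_taylor
      simpa using! h

end HolGerm

end

theorem corollary4p4 :
    (IsTopologicalRing HolGerm.HoloGerm ∧ ContinuousSMul ℂ HolGerm.HoloGerm) ∧
    (IsOpen {f : HolGerm.HoloGerm | IsUnit f} ∧
      ContinuousOn (fun f : HolGerm.HoloGerm => Ring.inverse f)
        {f : HolGerm.HoloGerm | IsUnit f}) ∧
    (∀ f : HolGerm.HoloGerm, IsUnit f ↔ f.valueAtZero ≠ 0) ∧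
    NuclearDef.IsNuclearSpace HolGerm.HoloGerm :=
  ⟨⟨inferInstance, inferInstance⟩,
    ⟨HolGerm.HoloGerm.isOpen_setOf_isUnit, HolGerm.HoloGerm.continuousOn_inverse⟩,
    HolGerm.HoloGerm.isUnit_iff, HolGerm.isNuclearSpace_holoGerm⟩
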